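/- Let $\mathcal{R}=\langle R;+,<,\ldots\rangle$ be a first-order structure that expands an ordered Abelian group and let $T$ be its complete theory. "Definable" means first-order definable with parameters, and topological notions refer to the order topology on $R$. Assume that $\mathcal{R}$ is definably complete (every nonempty definable $X\subseteq R$ with an upper bound has a least upper bound in $R$). An inp-pattern of depth $\kappa$ in $T$, in a finite tuple of variables $\bar x$, consists of formulas $\varphi_i(\bar x;\bar y_i)$, positive integers $k_i$ ($i<\kappa$) and tuples $\bar a_{i,j}$ ($i<\kappa$, $j<\omega$) from a model of $T$ such that, for each $i$, any $k_i$ of the formulas $\varphi_i(\bar x;\bar a_{i,j})$, $j<\omega$, are jointly inconsistent, while for every $\eta:\kappa\to\omega$ the set $\{\varphi_i(\bar x;\bar a_{i,\eta(i)}) : i<\kappa\}$ is consistent. Assume that $T$ is strong, in the sense that there is a cardinal $\kappa$ such that every inp-pattern in $T$ has depth less than $\kappa$ (this holds in particular if $T$ has no inp-pattern of infinite depth). The burden of $\mathcal{R}$ is less than $\kappa$ if $T$ has no inp-pattern of depth $\kappa$ in a single variable $x$, and otherwise it is at least $\kappa$; the burden of $\mathcal{R}$ is $\lambda$ if $\lambda^+$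 is the least cardinal $\kappa$ such that the burden is less than $\kappa$. Let $D\subseteq R$ be definable and discrete. The difference set $D'$ is the set of all $b-a$ where $a\in D$ is not maximal in $D$ and $b=\min\{c\in D: a<c\}$; put $D^{(0)}=D$ and $D^{(n+1)}=(D^{(n)})'$. If $n\in\mathbb{N}$ and $D^{(n)}$ is infinite, then the burden of $\mathcal{R}$ is at least $n+1$, and at least $n+2$ if $R$ is densely ordered. In particular, if $R$ is densely ordered and the burden of $\mathcal{R}$ is $2$, then $D'$ is finite. -/

import Mathlib

open scoped FirstOrder

universe u v w x

namespace OAG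

section Burden

variable {L : FirstOrder.Language.{u, v}}

/-- The set of formulas `ψ j (x₁, …, xₘ; b j)`, `j ∈ J`, with parameters `b j` in `M`, is
consistent (with the complete theory of `M` with parameters): one tuple in some elementary
extension of `M` satisfies all of them. -/
def Consistent {M : Type w} [L.Structure M] {m : ℕ} {J : Type x} {l : J → ℕ}
    (ψ : ∀ j, L.Formula (Fin m ⊕ Fin (l j))) (b : ∀ j, Fin (l j) → M) : Prop :=
  ∃ (N : Type (max u v w)) (_ : L.Structure N) (f : M ↪ₑ[L] N) (c : Fin m → N),
    ∀ j, (ψ j).Realize (Sum.elim c (f ∘ b j))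

/-- The formulas `φ i (x₁, …, xₘ; y)`, the numbers `k i` and the parameter tuples `a i j` of `M`
form an inp-pattern whose rows are indexed by `ι`. -/
structure IsInpPattern {M : Type w} [L.Structure M] {m : ℕ} {ι : Type x} {l : ι → ℕ}
    (φ : ∀ i, L.Formula (Fin m ⊕ Fin (l i))) (k : ι → ℕ)
    (a : ∀ i, ℕ → Fin (l i) → M) : Prop where
  /-- the `k i` are positive integers -/
  pos : ∀ i, 0 < k i
  /-- the `i`-th row is `k i`-inconsistent -/
  row_inconsistent : ∀ i, ∀ s : Finset ℕ, s.card = k i →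
    ¬ Consistent (fun _ : s => φ i) (fun j : s => a i j)
  /-- every path through the rows is consistent -/
  path_consistent : ∀ η : ι → ℕ, Consistent φ (fun i => a i (η i))

/-- There is an inp-pattern of depth `κ` in `m` free variables, with parameters in some model
of `T`. -/
def HasInpPattern (T : L.Theory) (m : ℕ) (κ : Cardinal.{w}) : Prop :=
  ∃ (M : FirstOrder.Language.Theory.ModelType.{u, v, max u v w} T) (ι : Type w) (l : ι → ℕ)
    (φ : ∀ i, L.Formula (Fin m ⊕ Fin (l i))) (k : ι → ℕ) (a : ∀ i, ℕ → Fin (l i) → M),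
    Cardinal.mk ι = κ ∧ IsInpPattern φ k a

/-- The theory `T` is strong: the depths of all inp-patterns in `T` (in any finite number of free
variables) lie below some cardinal. -/
def IsStrong (T : L.Theory) : Prop :=
  ∃ κ : Cardinal.{max u v w}, ∀ (m : ℕ) (μ : Cardinal.{max u v w}), HasInpPattern T m μ → μ < κ

/-- The burden of `T` is less than `κ`: there is no inp-pattern of depth `κ` in a single free
variable. -/
def BurdenLT (T : L.Theory) (κ : Cardinal.{w}) : Prop :=
  ¬ HasInpPattern T 1 κ

/-- The burden of `T` is at least `κ`, i.e. it is not less than `κ`. -/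
def BurdenGE (T : L.Theory) (κ : Cardinal.{w}) : Prop :=
  ¬ BurdenLT T κ

/-- The burden of `T` is (the cardinal) `μ`: the least `κ` such that the burden of `T` is less than
`κ` is the successor cardinal of `μ`. -/
def BurdenEq (T : L.Theory) (μ : Cardinal.{w}) : Prop :=
  IsLeast {κ : Cardinal.{w} | BurdenLT T κ} (Order.succ μ)

end Burden

/-- The `L`-structure on the ordered Abelian group `R` is an expansion of `⟨R; +, <⟩`: some binary
function symbol is interpreted as `+` and some binary relation symbol as `<`. -/
def IsExpansion (L : FirstOrder.Language.{u, v}) (R : Type w) [AddCommGroup R] [LinearOrder R]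
    [L.Structure R] : Prop :=
  (∃ add : L.Functions 2, ∀ z : Fin 2 → R, FirstOrder.Language.Structure.funMap add z = z 0 + z 1) ∧
  (∃ lt : L.Relations 2, ∀ z : Fin 2 → R, FirstOrder.Language.Structure.RelMap lt z ↔ z 0 < z 1)

/-- Every nonempty subset of `R` that is definable (with parameters) and bounded above has a least
upper bound in `R`. -/
def DefinablyComplete (L : FirstOrder.Language.{u, v}) (R : Type w) [LinearOrder R] [L.Structure R] : Prop :=
  ∀ X : Set R, (Set.univ : Set R).Definable₁ L X → X.Nonempty → BddAbove X → ∃ s, IsLUB X s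

/-- The difference set of `D`: all differences `b - a`, where `a ∈ D` and `b` is the successor
of `a` in `D`, i.e. the least element of `D` above `a`. -/
def diffSet {R : Type w} [AddCommGroup R] [LinearOrder R] (D : Set R) : Set R :=
  {d | ∃ a ∈ D, ∃ b, IsLeast {c | c ∈ D ∧ a < c} b ∧ d = b - a}

/-- The `n`-th iterated difference set. -/
def iterDiffSet {R : Type w} [AddCommGroup R] [LinearOrder R] (D : Set R) : ℕ → Set R
  | 0 => D
  | n + 1 => diffSet (iterDiffSet D n)

end OAG

/-! By compactness, here an ultrapower of `R`, an inp-pattern of finite depth only requires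
definable relations that have, for every `N`, an array with `N` parameters per row, pairwise
inconsistent rows and realized paths (`hasInpPattern_of_finite_arrays`).

Such arrays are lifted from `diffSet C` to `C` at the cost of one new row (`HasArrays.of_diffSet`).
Write a point as `a + y`, where `a` starts the cell of `C` containing it. The new row fixes `a`, and
the old rows speak about the offset `y`. The two are independent as long as `y` is nonnegative and
shorter than enough gaps, and `HasArrays` carries these bounds along. Since an infinite set gives
one row, `n` lifts from `iterDiffSet D n` give depth `n + 1`.

In a dense group one more row is needed. If infinitely many points of `iterDiffSet D n` are isolated
from the right, the offset from such a point gives a second row (`hasArrays_two`). Otherwise `n >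
0`, because `D` is discrete, and almost all gap lengths of `C = iterDiffSet D (n - 1)` are limits of
larger ones. Definable completeness then spreads gaps with lengths in infinitely many disjoint
windows arbitrarily far in one direction (`exists_unbounded_gaps`). Location, gap length and offset
vary independently, so `C` itself has three rows (`hasArrays_three`), again `n + 2` after lifting.
-/

namespace OAG

open FirstOrder FirstOrder.Language

/-! ### Closure properties of definable predicates. -/

section DefinablePredicates

variable (L : FirstOrder.Language.{u, v}) {R : Type w} [L.Structure R] {α β : Type}

/-- The predicate `P` on tuples is definable with parameters. -/
def DefPred (P : (α → R) → Prop) : Prop :=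
  (Set.univ : Set R).Definable L {z | P z}

/-- The function `t` on tuples is given by a term with parameters. -/
def DefTerm (t : (α → R) → R) : Prop :=
  (Set.univ : Set R).TermDefinable L t

variable {L}

theorem DefTerm.var (i : α) : DefTerm L (fun z : α → R => z i) :=
  ⟨Term.var i, rfl⟩

theorem DefTerm.const (r : R) : DefTerm L (fun _ : α → R => r) :=
  ⟨Constants.term (L.con (⟨r, trivial⟩ : (Set.univ : Set R))), by
    funext z
    simp⟩

theorem DefPred.subst {P : (β → R) → Prop} (hP : DefPred L P) {t : β → (α → R) → R}
    (ht : ∀ b, DefTerm L (t b)) : DefPred L (fun z => P (fun b => t b z)) := by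
  obtain ⟨φ, hφ⟩ := hP
  choose τ hτ using ht
  refine ⟨φ.subst τ, ?_⟩
  ext z
  have h := Set.ext_iff.1 hφ (fun b => t b z)
  have h' : (fun b => t b z) = fun b => (τ b).realize z := by
    funext b
    rw [hτ b]
  simp only [Set.mem_ofPred_eq] at h ⊢
  rw [h, h']
  exact BoundedFormula.realize_subst.symm

theorem DefPred.and {P Q : (α → R) → Prop} (hP : DefPred L P) (hQ : DefPred L Q) :
    DefPred L (fun z => P z ∧ Q z) :=
  Set.Definable.inter hP hQ

theorem DefPred.not {P : (α → R) → Prop} (hP : DefPred L P) : DefPred L (fun z => ¬ P z) :=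
  Set.Definable.compl hP

theorem DefPred.imp {P Q : (α → R) → Prop} (hP : DefPred L P) (hQ : DefPred L Q) :
    DefPred L (fun z => P z → Q z) := by
  have h := (hP.and hQ.not).not
  simpa only [not_and, not_not] using h

theorem DefPred.ex {P : R → (α → R) → Prop}
    (hP : DefPred L (fun z : α ⊕ Fin 1 → R => P (z (Sum.inr 0)) (fun i => z (Sum.inl i)))) :
    DefPred L (fun z => ∃ r, P r z) := by
  have h := Set.Definable.image_comp_sumInl_fin 1 hP
  refine (congrArg ((Set.univ : Set R).Definable L) ?_).mp h
  ext z
  constructor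
  · rintro ⟨y, hy, rfl⟩
    exact ⟨_, hy⟩
  · rintro ⟨r, hr⟩
    exact ⟨Sum.elim z (fun _ => r), hr, rfl⟩

theorem DefPred.all {P : R → (α → R) → Prop}
    (hP : DefPred L (fun z : α ⊕ Fin 1 → R => P (z (Sum.inr 0)) (fun i => z (Sum.inl i)))) :
    DefPred L (fun z => ∀ r, P r z) := by
  have h := (DefPred.ex (P := fun r z => ¬ P r z) hP.not).not
  simpa only [not_exists, not_not] using h

theorem DefPred.mem {C : Set R} (hC : (Set.univ : Set R).Definable₁ L C) {t : (α → R) → R}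
    (ht : DefTerm L t) : DefPred L (fun z => t z ∈ C) :=
  DefPred.subst (P := fun z : Fin 1 → R => z 0 ∈ C) hC (fun _ => ht)

theorem DefPred.eq {s t : (α → R) → R} (hs : DefTerm L s) (ht : DefTerm L t) :
    DefPred L (fun z => s z = t z) := by
  obtain ⟨σ, rfl⟩ := hs
  obtain ⟨τ, rfl⟩ := ht
  exact ⟨σ.equal τ, by ext z; simp⟩

end DefinablePredicates

section Expansion

variable {L : FirstOrder.Language.{u, v}} {R : Type w} [AddCommGroup R] [LinearOrder R]
  [L.Structure R] {α : Type}

theorem DefTerm.add (hexp : IsExpansion L R) {s t : (α → R) → R} (hs : DefTerm L s)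
    (ht : DefTerm L t) : DefTerm L (fun z => s z + t z) := by
  obtain ⟨σ, rfl⟩ := hs
  obtain ⟨τ, rfl⟩ := ht
  obtain ⟨add, hadd⟩ := hexp.1
  refine ⟨Term.func (Sum.inl add) ![σ, τ], ?_⟩
  funext z
  have h := hadd (fun i => (![σ, τ] i).realize z)
  simp only [Matrix.cons_val_zero, Matrix.cons_val_one] at h
  rw [← h]
  exact ((lhomWithConstants L (Set.univ : Set R)).map_onFunction add _).symm

theorem DefPred.lt (hexp : IsExpansion L R) {s t : (α → R) → R} (hs : DefTerm L s)
    (ht : DefTerm L t) : DefPred L (fun z => s z < t z) := by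
  obtain ⟨lt, hlt⟩ := hexp.2
  have h : DefPred L (fun z : Fin 2 → R => z 0 < z 1) := by
    refine Set.Definable.mono (A := ∅) ?_ (Set.empty_subset _)
    rw [Set.empty_definable_iff]
    refine ⟨lt.formula ![Term.var 0, Term.var 1], ?_⟩
    ext z
    simp [Formula.realize_rel, hlt]
  have h' := h.subst (t := ![s, t]) (by
    intro i
    fin_cases i
    · exact hs
    · exact ht)
  exact h'

theorem DefPred.le (hexp : IsExpansion L R) {s t : (α → R) → R} (hs : DefTerm L s)
    (ht : DefTerm L t) : DefPred L (fun z => s z ≤ t z) := by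
  simpa only [not_lt] using (DefPred.lt hexp ht hs).not

end Expansion

/-! ### From finite arrays in `R` to an inp-pattern in an ultrapower. -/

section Ultrapower

variable {L : FirstOrder.Language.{u, v}} {R : Type w} [L.Structure R]

/-- A definable relation is given by a formula with finitely many parameters. -/
theorem DefPred.exists_formula {m p : ℕ} {S : (Fin m ⊕ Fin p → R) → Prop} (hS : DefPred L S) :
    ∃ (q : ℕ) (ψ : L.Formula (Fin m ⊕ Fin (p + q))) (e : Fin q → R),
      ∀ (x : Fin m → R) (a : Fin p → R),
        ψ.Realize (Sum.elim x (Fin.append a e)) ↔ S (Sum.elim x a) := by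
  obtain ⟨A, -, hA⟩ := Set.definable_iff_finitely_definable.1 hS
  obtain ⟨φ, hφ⟩ := Set.definable_iff_exists_formula_sum.1 hA
  let g := A.equivFin
  refine ⟨A.card, φ.relabel (Sum.elim (fun r => Sum.inr (Fin.natAdd p (g r)))
    (Sum.map id (Fin.castAdd _))), fun i => (g.symm i : R), fun x a => ?_⟩
  have h := Set.ext_iff.1 hφ (Sum.elim x a)
  simp only [Set.mem_ofPred_eq] at h
  rw [h, Formula.realize_relabel]
  refine iff_of_eq (congrArg _ ?_)
  funext i
  rcases i with r | i | i <;> simp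

/-- The parameter tuples `y`, `z` for which `ψ (x; y)` and `ψ (x; z)` have a common solution. -/
noncomputable def overlap {m p : ℕ} (ψ : L.Formula (Fin m ⊕ Fin p)) : L.Formula (Fin p ⊕ Fin p) :=
  Formula.iExs (Fin m)
    (ψ.relabel (Sum.elim Sum.inr (fun k => Sum.inl (Sum.inl k))) ⊓
      ψ.relabel (Sum.elim Sum.inr (fun k => Sum.inl (Sum.inr k))))

theorem realize_overlap {K : Type x} [L.Structure K] {m p : ℕ} {ψ : L.Formula (Fin m ⊕ Fin p)}
    {y z : Fin p → K} : (overlap ψ).Realize (Sum.elim y z) ↔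
      ∃ x : Fin m → K, ψ.Realize (Sum.elim x y) ∧ ψ.Realize (Sum.elim x z) := by
  simp only [overlap, Formula.realize_iExs, Formula.realize_inf, Formula.realize_relabel]
  refine exists_congr fun x => and_congr (iff_of_eq (congrArg _ ?_)) (iff_of_eq (congrArg _ ?_)) <;>
    (funext k; rcases k with k | k <;> rfl)

/-- If any two of the formulas `ψ (x; a j)` are inconsistent in `M`, they form a `2`-inconsistent
family. -/
theorem not_consistent_of_not_realize_overlap {M : Type w} [L.Structure M] {m p : ℕ}
    (ψ : L.Formula (Fin m ⊕ Fin p)) (a : ℕ → Fin p → M)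
    (h : ∀ j j', j ≠ j' → ¬ (overlap ψ).Realize (Sum.elim (a j) (a j')))
    (s : Finset ℕ) (hs : s.card = 2) :
    ¬ Consistent (fun _ : s => ψ) (fun j : s => a j) := by
  rintro ⟨N, _, f, c, hc⟩
  obtain ⟨j, j', hjj, rfl⟩ := Finset.card_eq_two.1 hs
  have hN : (overlap ψ).Realize (Sum.elim (f ∘ a j) (f ∘ a j')) :=
    realize_overlap.2 ⟨c, hc ⟨j, by simp⟩, hc ⟨j', by simp⟩⟩
  rw [← Sum.comp_elim, f.map_formula] at hN
  exact h j j' hjj hN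

theorem consistent_of_realize {M : Type (max u v w)} [L.Structure M] {m : ℕ} {J : Type x}
    {l : J → ℕ} (ψ : ∀ j, L.Formula (Fin m ⊕ Fin (l j))) (b : ∀ j, Fin (l j) → M)
    (c : Fin m → M) (hc : ∀ j, (ψ j).Realize (Sum.elim c (b j))) : Consistent ψ b :=
  ⟨M, _, ElementaryEmbedding.refl L M, c, hc⟩

/-- The lift of `ℕ` puts the ultrapower in the universe that `HasInpPattern` prescribes for models.
-/
theorem exists_eventually_atTop_ultrafilter :
    ∃ U : Ultrafilter (ULift.{x} ℕ), ∀ n : ℕ, ∀ᶠ N in (U : Filter (ULift.{x} ℕ)), n ≤ N.down := by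
  have : (Filter.comap (ULift.down : ULift.{x} ℕ → ℕ) Filter.atTop).NeBot :=
    Filter.NeBot.comap_of_surj inferInstance ULift.down_surjective
  refine ⟨Ultrafilter.of (Filter.comap ULift.down Filter.atTop), fun n => ?_⟩
  exact Ultrafilter.of_le _ (Filter.tendsto_comap.eventually (Filter.eventually_ge_atTop n))

/-- If definable relations admit arbitrarily wide finite arrays with pairwise inconsistent rows and
consistent paths in `R`, then the theory of `R` has an inp-pattern with the corresponding depth. -/
theorem hasInpPattern_of_finite_arrays [Nonempty R] {r p : ℕ}
    (S : Fin r → R → (Fin p → R) → Prop)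
    (hS : ∀ i, DefPred L (fun z : Fin 1 ⊕ Fin p → R => S i (z (Sum.inl 0)) (fun j => z (Sum.inr j))))
    (h : ∀ N : ℕ, ∃ a : Fin r → ℕ → Fin p → R,
      (∀ i, ∀ j < N, ∀ j' < N, j ≠ j' → ∀ x, S i x (a i j) → ¬ S i x (a i j')) ∧
      ∀ η : Fin r → ℕ, (∀ i, η i < N) → ∃ x, ∀ i, S i x (a i (η i))) :
    HasInpPattern.{u, v, max u v w} (L.completeTheory R) 1 (r : Cardinal) := by
  obtain ⟨U, hU⟩ := exists_eventually_atTop_ultrafilter.{max u v}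
  choose q ψ e hψ using fun i => (hS i).exists_formula
  choose a ha hη using h
  let M := (U : Filter (ULift.{max u v} ℕ)).Product (fun _ => R)
  have hM : M ⊨ L.completeTheory R := by
    rw [Theory.model_iff]
    intro φ hφ
    rw [Ultraproduct.sentence_realize]
    exact Filter.Eventually.of_forall fun _ => hφ
  let b : ∀ i : Fin r, ℕ → Fin (p + q i) → ULift.{max u v} ℕ → R :=
    fun i j k N => Fin.append (a N.down i j) (e i) k
  let b' : ∀ i : Fin r, ℕ → Fin (p + q i) → M := fun i j k => (b i j k : M)
  refine ⟨Theory.ModelType.of _ M, ULift (Fin r), fun i => p + q i.down, fun i => ψ i.down,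
    fun _ => 2, fun i => b' i.down, by simp, ⟨fun _ => two_pos, ?_, ?_⟩⟩
  · rintro ⟨i⟩
    refine not_consistent_of_not_realize_overlap (M := M) (ψ i) (b' i) fun j j' hjj hN => ?_
    have hcast : Sum.elim (b' i j) (b' i j') =
        fun k => ((Sum.elim (b i j) (b i j') k : ULift.{max u v} ℕ → R) : M) := by
      funext k
      rcases k with k | k <;> rfl
    rw [hcast] at hN
    -- The array of width `n` is only controlled at columns below `n`, so an index beyond both `j`
    -- and `j'` is chosen.
    have hev := ((Ultraproduct.realize_formula_cast _ _).1 hN).and (hU (max j j' + 1))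
    obtain ⟨n, hn, hjn⟩ := hev.exists
    have hsplit : (fun k => Sum.elim (b i j) (b i j') k n) =
        Sum.elim (fun k => b i j k n) (fun k => b i j' k n) := by
      funext k
      rcases k with k | k <;> rfl
    rw [hsplit, realize_overlap] at hn
    obtain ⟨x, hx, hx'⟩ := hn
    exact ha n.down i j (by omega) j' (by omega) hjj (x 0) ((hψ i x _).1 hx) ((hψ i x _).1 hx')
  · intro η
    have hx : ∀ n : ℕ, ∃ x, (∀ i, η ⟨i⟩ < n) → ∀ i, S i x (a n i (η ⟨i⟩)) := by
      intro n
      by_cases hn : ∀ i, η ⟨i⟩ < n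
      · obtain ⟨x, hx⟩ := hη n (fun i => η ⟨i⟩) hn
        exact ⟨x, fun _ => hx⟩
      · exact ⟨Classical.arbitrary R, fun h => absurd h hn⟩
    choose x hx using hx
    refine consistent_of_realize (M := M) (fun i : ULift (Fin r) => ψ i.down) _
      (fun _ => ((fun n => x n.down : ULift.{max u v} ℕ → R) : M)) ?_
    rintro ⟨i⟩
    have hcast : Sum.elim (fun _ => ((fun n => x n.down : ULift.{max u v} ℕ → R) : M))
        (b' i (η ⟨i⟩)) = fun k => ((Sum.elim (fun (_ : Fin 1) n => x n.down) (b i (η ⟨i⟩)) k :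
          ULift.{max u v} ℕ → R) : M) := by
      funext k
      rcases k with k | k <;> rfl
    refine (congrArg (ψ i).Realize hcast).mpr ((Ultraproduct.realize_formula_cast _ _).2 ?_)
    have hall : ∀ᶠ n in (U : Filter (ULift.{max u v} ℕ)), ∀ i, η ⟨i⟩ < n.down :=
      Filter.eventually_all.2 fun i => (hU (η ⟨i⟩ + 1)).mono fun n hn => hn
    refine hall.mono fun n hn => ?_
    have hsplit : (fun k => Sum.elim (fun (_ : Fin 1) (n : ULift.{max u v} ℕ) => x n.down)
        (b i (η ⟨i⟩)) k n) = Sum.elim (fun _ => x n.down) (fun k => b i (η ⟨i⟩) k n) := by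
      funext k
      rcases k with k | k <;> rfl
    rw [hsplit]
    exact (hψ i _ _).2 (hx n.down hn i)

end Ultrapower

/-! ### Gaps and cells of a definable set. -/

section Gaps

variable {R : Type w} [AddCommGroup R] [LinearOrder R]

/-- `a` is a point of `C`, and `a + g` is its successor in `C`. -/
def IsGap (C : Set R) (a g : R) : Prop :=
  a ∈ C ∧ a + g ∈ C ∧ a < a + g ∧ ∀ c, c ∈ C → a < c → a + g ≤ c

/-- The point `z` lies in the half-open cell of `C` that starts at `a` and has length `g`. -/
def InCell (C : Set R) (z a g : R) : Prop :=
  IsGap C a g ∧ a ≤ z ∧ z < a + g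

theorem mem_diffSet_iff {C : Set R} {g : R} : g ∈ diffSet C ↔ ∃ a, IsGap C a g := by
  constructor
  · rintro ⟨a, ha, b, ⟨⟨hb, hab⟩, hmin⟩, rfl⟩
    refine ⟨a, ha, ?_, ?_, fun c hc hac => ?_⟩
    · simpa using hb
    · simpa using hab
    · simpa using hmin ⟨hc, hac⟩
  · rintro ⟨a, ha, hb, hab, hmin⟩
    exact ⟨a, ha, a + g, ⟨⟨hb, hab⟩, fun c hc => hmin c hc.1 hc.2⟩, by simp⟩

theorem IsGap.pos [IsOrderedAddMonoid R] {C : Set R} {a g : R} (h : IsGap C a g) : 0 < g :=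
  (lt_add_iff_pos_right a).1 h.2.2.1

theorem diffSet_pos [IsOrderedAddMonoid R] {C : Set R} : ∀ g ∈ diffSet C, 0 < g := fun _ hg =>
  (mem_diffSet_iff.1 hg).elim fun _ h => h.pos

/-- Distinct cells are disjoint. Hence the start, the length and the offset of a point are well
defined, which makes the rows built from them inconsistent. -/
theorem InCell.unique {C : Set R} {z a g a' g' : R} (h : InCell C z a g)
    (h' : InCell C z a' g') : a = a' ∧ g = g' := by
  obtain ⟨⟨ha, hb, hab, hmin⟩, h1, h2⟩ := h
  obtain ⟨⟨ha', hb', hab', hmin'⟩, h1', h2'⟩ := h'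
  have haa : a = a' := by
    rcases lt_trichotomy a a' with hlt | heq | hlt
    · exact absurd (h2.trans_le (hmin _ ha' hlt)) (not_lt.2 h1')
    · exact heq
    · exact absurd (h2'.trans_le (hmin' _ ha hlt)) (not_lt.2 h1)
  subst haa
  exact ⟨rfl, add_left_cancel (le_antisymm (hmin _ hb' hab') (hmin' _ hb hab))⟩

variable {L : FirstOrder.Language.{u, v}} [L.Structure R] {α : Type} {C : Set R}

theorem DefPred.isGap (hexp : IsExpansion L R) (hC : (Set.univ : Set R).Definable₁ L C)
    {s t : (α → R) → R} (hs : DefTerm L s) (ht : DefTerm L t) :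
    DefPred L (fun z => IsGap C (s z) (t z)) := by
  have h : DefPred L (fun z : Fin 2 → R => IsGap C (z 0) (z 1)) :=
    (DefPred.mem hC (.var 0)).and ((DefPred.mem hC (.add hexp (.var 0) (.var 1))).and
      ((DefPred.lt hexp (.var 0) (.add hexp (.var 0) (.var 1))).and
        (DefPred.all ((DefPred.mem hC (.var _)).imp ((DefPred.lt hexp (.var _) (.var _)).imp
          (DefPred.le hexp (.add hexp (.var _) (.var _)) (.var _)))))))
  refine h.subst (t := ![s, t]) fun i => ?_
  fin_cases i
  · exact hs
  · exact ht

theorem DefPred.inCell (hexp : IsExpansion L R) (hC : (Set.univ : Set R).Definable₁ L C)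
    {r s t : (α → R) → R} (hr : DefTerm L r) (hs : DefTerm L s) (ht : DefTerm L t) :
    DefPred L (fun z => InCell C (r z) (s z) (t z)) :=
  (DefPred.isGap hexp hC hs ht).and
    ((DefPred.le hexp hs hr).and (DefPred.lt hexp hr (.add hexp hs ht)))

theorem definable_diffSet (hexp : IsExpansion L R) (hC : (Set.univ : Set R).Definable₁ L C) :
    (Set.univ : Set R).Definable₁ L (diffSet C) := by
  have h : DefPred L (fun z : Fin 1 → R => ∃ a, IsGap C a (z 0)) :=
    DefPred.ex (DefPred.isGap hexp hC (.var _) (.var _))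
  simp only [← mem_diffSet_iff] at h
  exact h

theorem definable_iterDiffSet (hexp : IsExpansion L R)
    (hC : (Set.univ : Set R).Definable₁ L C) (n : ℕ) :
    (Set.univ : Set R).Definable₁ L (iterDiffSet C n) := by
  induction n with
  | zero => exact hC
  | succ n ih => exact definable_diffSet hexp ih

end Gaps

/-! ### Finite sets and sequences in linear orders. -/

section Order

variable {R : Type w} [LinearOrder R]

/-- The lowest `N` points will serve as parameters, and the points above them as the upper bounds
`F` in `HasArrays`. -/
theorem exists_initial_segment [Nonempty R] (A : Finset R) {N M : ℕ} (h : N + M ≤ A.card) :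
    ∃ (d : ℕ → R) (F : Finset R), M ≤ F.card ∧ F ⊆ A ∧ (∀ j < N, d j ∈ A) ∧
      (∀ j j', j < j' → j' < N → d j < d j') ∧ ∀ j < N, ∀ c ∈ F, d j < c := by
  classical
  let e := A.orderEmbOfFin rfl
  refine ⟨fun j => if hj : j < A.card then e ⟨j, hj⟩ else Classical.arbitrary R,
    (Finset.univ.filter fun i : Fin A.card => N ≤ i).map e.toEmbedding, ?_, ?_, ?_, ?_, ?_⟩
  · rw [Finset.card_map]
    have h' : (Finset.univ : Finset (Fin M)).card ≤
        (Finset.univ.filter fun i : Fin A.card => N ≤ i).card := by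
      refine Finset.card_le_card_of_injOn (fun i => ⟨N + i, by omega⟩) ?_ ?_
      · intro i _
        simp
      · intro i _ j _ hij
        simp only [Fin.mk.injEq] at hij
        exact Fin.ext (by omega)
    simpa using h'
  · intro c hc
    obtain ⟨i, -, rfl⟩ := Finset.mem_map.1 hc
    exact A.orderEmbOfFin_mem rfl i
  · intro j hj
    simp only
    rw [dif_pos (by omega)]
    exact A.orderEmbOfFin_mem rfl _
  · intro j j' hjj hj'
    simp only
    rw [dif_pos (by omega), dif_pos (by omega)]
    exact e.strictMono hjj
  · intro j hj c hc
    obtain ⟨i, hi, rfl⟩ := Finset.mem_map.1 hc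
    simp only
    rw [dif_pos (by omega)]
    exact e.strictMono (hj.trans_le (Finset.mem_filter.1 hi).2)

theorem exists_strictMono_Ioo [DenselyOrdered R] {a b : R} (hab : a < b) :
    ∃ t : ℕ → R, StrictMono t ∧ ∀ n, a < t n ∧ t n < b := by
  have : Nonempty (Set.Ioo a b) := (Set.nonempty_Ioo.2 hab).to_subtype
  obtain ⟨t, ht⟩ := Nat.exists_strictMono (Set.Ioo a b)
  exact ⟨fun n => t n, fun _ _ h => ht h, fun n => (t n).2⟩

theorem exists_pos_forall_le {ι : Type*} [Zero R] (hpos : ∃ r : R, 0 < r) (A : Finset ι)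
    (f : ι → R) (hf : ∀ i ∈ A, 0 < f i) : ∃ ε > 0, ∀ i ∈ A, ε ≤ f i := by
  obtain ⟨r, hr⟩ := hpos
  classical
  induction A using Finset.induction_on with
  | empty => exact ⟨r, hr, by simp⟩
  | insert i A _ ih =>
    obtain ⟨ε, hε, h⟩ := ih fun j hj => hf j (Finset.mem_insert_of_mem hj)
    refine ⟨min ε (f i), lt_min hε (hf i (Finset.mem_insert_self _ _)), fun j hj => ?_⟩
    rcases Finset.mem_insert.1 hj with rfl | hj
    · exact min_le_right _ _
    · exact (min_le_left _ _).trans (h j hj)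

end Order

/-! ### Arrays and their passage from the difference set to the set. -/

section Arrays

variable (L : FirstOrder.Language.{u, v}) {R : Type w} [AddCommGroup R] [LinearOrder R]
  [L.Structure R]

/-- There are `r` definable relations with arbitrarily wide finite arrays of parameters whose rows
are pairwise inconsistent and all of whose paths are realized by elements below arbitrarily many
elements of `C`, which are nonnegative in case `C` consists of positive elements. -/
def HasArrays (C : Set R) (r : ℕ) : Prop :=
  ∃ S : Fin r → R → (Fin 3 → R) → Prop,
    (∀ i, DefPred L
      (fun z : Fin 1 ⊕ Fin 3 → R => S i (z (Sum.inl 0)) (fun j => z (Sum.inr j)))) ∧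
    ∀ N M : ℕ, ∃ (a : Fin r → ℕ → Fin 3 → R) (F : Finset R), M ≤ F.card ∧ (F : Set R) ⊆ C ∧
      (∀ i, ∀ j < N, ∀ j' < N, j ≠ j' → ∀ x, S i x (a i j) → ¬ S i x (a i j')) ∧
      ∀ η : Fin r → ℕ, (∀ i, η i < N) →
        ∃ x, (∀ i, S i x (a i (η i))) ∧ (∀ c ∈ F, x < c) ∧ ((∀ c ∈ C, 0 < c) → 0 ≤ x)

variable {L} {C : Set R}

theorem HasArrays.hasInpPattern {r : ℕ} (h : HasArrays L C r) :
    HasInpPattern.{u, v, max u v w} (L.completeTheory R) 1 (r : Cardinal) := by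
  obtain ⟨S, hS, h⟩ := h
  refine hasInpPattern_of_finite_arrays S hS fun N => ?_
  obtain ⟨a, F, -, -, ha, hη⟩ := h N 0
  refine ⟨a, ha, fun η hN => ?_⟩
  obtain ⟨x, hx, -⟩ := hη η hN
  exact ⟨x, hx⟩

theorem hasArrays_one (hC : C.Infinite) : HasArrays L C 1 := by
  refine ⟨fun _ x p => x = p 0, fun _ => DefPred.eq (.var _) (.var _), fun N M => ?_⟩
  obtain ⟨A, hAC, hA⟩ := hC.exists_subset_card_eq (N + M)
  obtain ⟨d, F, hF, hFA, hd, hmono, hlt⟩ := exists_initial_segment A hA.ge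
  have hinj : ∀ j < N, ∀ j' < N, j ≠ j' → d j ≠ d j' := by
    intro j hj j' hj' hne
    rcases hne.lt_or_gt with h | h
    · exact (hmono _ _ h hj').ne
    · exact (hmono _ _ h hj).ne'
  refine ⟨fun _ j _ => d j, F, hF, fun c hc => hAC (hFA hc), ?_, ?_⟩
  · intro _ j hj j' hj' hne x h h'
    exact hinj j hj j' hj' hne (h.symm.trans h')
  · intro η hη
    refine ⟨d (η 0), fun i => by rw [Subsingleton.elim i 0], hlt _ (hη 0), fun hpos => ?_⟩
    exact (hpos _ (hAC (hd _ (hη 0)))).le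

/-- `S₀` names the start of the cell of `x`, and `S'` applies the old relations to the offset of `x`
in its cell. -/
theorem HasArrays.of_diffSet [IsOrderedAddMonoid R] (hexp : IsExpansion L R)
    (hC : (Set.univ : Set R).Definable₁ L C) {r : ℕ} (h : HasArrays L (diffSet C) r) :
    HasArrays L C (r + 1) := by
  obtain ⟨S, hS, h⟩ := h
  let S₀ : R → (Fin 3 → R) → Prop := fun x p => ∃ g, InCell C x (p 0) g
  let S' : Fin r → R → (Fin 3 → R) → Prop := fun i x p =>
    ∃ a, ∃ g, ∃ y, InCell C x a g ∧ a + y = x ∧ S i y p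
  refine ⟨Fin.cons S₀ S', Fin.forall_fin_succ.2 ⟨?_, fun i => ?_⟩, fun N M => ?_⟩
  · change DefPred L (fun z : Fin 1 ⊕ Fin 3 → R =>
      ∃ g, InCell C (z (Sum.inl 0)) (z (Sum.inr 0)) g)
    exact DefPred.ex (DefPred.inCell hexp hC (.var _) (.var _) (.var _))
  · change DefPred L (fun z : Fin 1 ⊕ Fin 3 → R => ∃ a, ∃ g, ∃ y,
      InCell C (z (Sum.inl 0)) a g ∧ a + y = z (Sum.inl 0) ∧ S i y (fun j => z (Sum.inr j)))
    refine DefPred.ex (DefPred.ex (DefPred.ex ((DefPred.inCell hexp hC (.var _) (.var _)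
      (.var _)).and ((DefPred.eq (.add hexp (.var _) (.var _)) (.var _)).and ?_))))
    refine (hS i).subst (t := Sum.elim (fun _ z => z (Sum.inr 0))
      (fun j z => z (Sum.inl (Sum.inl (Sum.inl (Sum.inr j)))))) ?_
    rintro (b | b)
    · exact .var _
    · exact .var _
  -- Each length in `G` exceeds every offset used. Of the `N + M` gaps with these lengths, `N`
  -- supply the new row and the others the new bounds.
  · obtain ⟨a, G, hG, hGC, hrow, hpath⟩ := h N (N + M)
    have hd : ∀ g, ∃ d, g ∈ G → IsGap C d g := fun g => by
      by_cases hg : g ∈ G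
      · obtain ⟨d, hd⟩ := mem_diffSet_iff.1 (hGC hg)
        exact ⟨d, fun _ => hd⟩
      · exact ⟨0, fun h => absurd h hg⟩
    choose d hd using hd
    have hdinj : Set.InjOn d G := by
      intro g hg g' hg' heq
      have h1 := hd g hg
      have h2 := hd g' hg'
      rw [← heq] at h2
      exact (InCell.unique ⟨h1, le_rfl, h1.2.2.1⟩ ⟨h2, le_rfl, h2.2.2.1⟩).2
    obtain ⟨b, F, hF, hFA, hb, hmono, hlt⟩ := exists_initial_segment (N := N) (M := M)
      (G.image d) (by rwa [Finset.card_image_of_injOn hdinj])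
    have himage : ∀ c ∈ G.image d, ∃ g ∈ G, IsGap C c g := by
      intro c hc
      obtain ⟨g, hg, rfl⟩ := Finset.mem_image.1 hc
      exact ⟨g, hg, hd g hg⟩
    refine ⟨Fin.cons (fun j _ => b j) a, F, hF, ?_, Fin.forall_fin_succ.2 ⟨?_, fun i => ?_⟩, ?_⟩
    · intro c hc
      obtain ⟨g, -, hg⟩ := himage c (hFA hc)
      exact hg.1
    · rintro j hj j' hj' hne x ⟨g, hg⟩ ⟨g', hg'⟩
      have heq : b j = b j' := (hg.unique hg').1
      rcases hne.lt_or_gt with h | h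
      · exact (hmono _ _ h hj').ne heq
      · exact (hmono _ _ h hj).ne' heq
    · rintro j hj j' hj' hne x ⟨e, g, y, hg, hy, hs⟩ ⟨e', g', y', hg', hy', hs'⟩
      obtain ⟨rfl, -⟩ := hg.unique hg'
      obtain rfl : y = y' := add_left_cancel (hy.trans hy'.symm)
      exact hrow i j hj j' hj' hne y hs hs'
    · intro η hη
      obtain ⟨x, hx, hxG, hx0⟩ := hpath (fun i => η i.succ) fun i => hη _
      have hx0 := hx0 diffSet_pos
      obtain ⟨g, hg, hgap⟩ := himage _ (hb _ (hη 0))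
      have hcell : InCell C (b (η 0) + x) (b (η 0)) g :=
        ⟨hgap, le_add_of_nonneg_right hx0, (add_lt_add_iff_left _).2 (hxG g hg)⟩
      refine ⟨b (η 0) + x, Fin.forall_fin_succ.2
        ⟨⟨g, hcell⟩, fun i => ⟨_, g, x, hcell, rfl, hx i⟩⟩, ?_, ?_⟩
      · intro c hc
        obtain ⟨g', -, hg'⟩ := himage c (hFA hc)
        exact hcell.2.2.trans_le (hgap.2.2.2 c hg'.1 (hlt _ (hη 0) c hc))
      · intro hpos
        exact add_nonneg (hpos _ hgap.1).le hx0

theorem HasArrays.of_iterDiffSet [IsOrderedAddMonoid R] (hexp : IsExpansion L R)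
    (hC : (Set.univ : Set R).Definable₁ L C) {n : ℕ} {r : ℕ}
    (h : HasArrays L (iterDiffSet C n) r) : HasArrays L C (n + r) := by
  induction n generalizing r with
  | zero => rwa [Nat.zero_add]
  | succ n ih =>
    have h' := ih (h.of_diffSet hexp (definable_iterDiffSet hexp hC n))
    rwa [Nat.add_right_comm]

/-- `e` is the only point of `C` in some interval `[e, e + ε)`. -/
def RightIsolated (C : Set R) (e : R) : Prop :=
  ∃ ε > 0, ∀ c ∈ C, e < c → e + ε ≤ c

/-- Finitely many right-isolated points share a free interval of length `ε` to their right. One row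
selects the point, the other the offset in `[0, ε)`. Points of `C` may lack successors, so `ε`,
passed as a parameter, replaces the cells. -/
theorem hasArrays_two [IsOrderedAddMonoid R] [DenselyOrdered R] (hexp : IsExpansion L R)
    (hC : (Set.univ : Set R).Definable₁ L C) (hinf : {e ∈ C | RightIsolated C e}.Infinite) :
    HasArrays L C 2 := by
  let S₀ : R → (Fin 3 → R) → Prop := fun x p => p 0 ≤ x ∧ x < p 0 + p 1
  let S₁ : R → (Fin 3 → R) → Prop := fun x p =>
    ∃ e, ∃ y, e ∈ C ∧ (∀ c, c ∈ C → e < c → e + p 2 ≤ c) ∧ e + y = x ∧ 0 ≤ y ∧ y < p 2 ∧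
      p 0 ≤ y ∧ y < p 1
  refine ⟨![S₀, S₁], Fin.forall_fin_two.2 ⟨?_, ?_⟩, fun N M => ?_⟩
  · exact (DefPred.le hexp (.var _) (.var _)).and
      (DefPred.lt hexp (.var _) (.add hexp (.var _) (.var _)))
  · exact DefPred.ex (DefPred.ex ((DefPred.mem hC (.var _)).and ((DefPred.all
      ((DefPred.mem hC (.var _)).imp ((DefPred.lt hexp (.var _) (.var _)).imp
        (DefPred.le hexp (.add hexp (.var _) (.var _)) (.var _))))).and
      ((DefPred.eq (.add hexp (.var _) (.var _)) (.var _)).and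
      ((DefPred.le hexp (.const 0) (.var _)).and ((DefPred.lt hexp (.var _) (.var _)).and
      ((DefPred.le hexp (.var _) (.var _)).and (DefPred.lt hexp (.var _) (.var _)))))))))
  · obtain ⟨A, hAC, hA⟩ := hinf.exists_subset_card_eq (N + M)
    have hpos : ∃ r : R, 0 < r := by
      obtain ⟨e, -, ε, hε, -⟩ := hinf.nonempty
      exact ⟨ε, hε⟩
    have hε : ∀ e, ∃ ε, e ∈ A → 0 < ε ∧ ∀ c ∈ C, e < c → e + ε ≤ c := fun e => by
      by_cases he : e ∈ A
      · obtain ⟨-, ε, h⟩ := hAC he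
        exact ⟨ε, fun _ => h⟩
      · exact ⟨0, fun h => absurd h he⟩
    choose f hf using hε
    obtain ⟨ε, hε, hεf⟩ := exists_pos_forall_le hpos A f fun e he => (hf e he).1
    have hAε : ∀ e ∈ A, ∀ c ∈ C, e < c → e + ε ≤ c := fun e he c hc hec =>
      (add_le_add_right (hεf e he) e).trans ((hf e he).2 c hc hec)
    obtain ⟨d, F, hF, hFA, hd, hmono, hlt⟩ := exists_initial_segment A hA.ge
    obtain ⟨t, ht, htε⟩ := exists_strictMono_Ioo hε
    have hC' : ∀ e ∈ A, e ∈ C := fun e he => (hAC he).1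
    refine ⟨![fun j => ![d j, ε, 0], fun j => ![t j, t (j + 1), ε] ], F, hF,
      fun c hc => hC' c (hFA hc), Fin.forall_fin_two.2 ⟨?_, ?_⟩, ?_⟩
    · have key : ∀ j j' x, j < j' → j' < N → x < d j + ε → ¬ d j' ≤ x := fun j j' x h h' hx =>
        not_le.2 (hx.trans_le (hAε _ (hd j (h.trans h')) _ (hC' _ (hd j' h')) (hmono _ _ h h')))
      rintro j hj j' hj' hne x ⟨h1, h2⟩ ⟨h1', h2'⟩
      rcases hne.lt_or_gt with h | h
      · exact key j j' x h hj' h2 h1'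
      · exact key j' j x h hj h2' h1
    · rintro j hj j' hj' hne x ⟨e, y, he, hgap, hx, h0, hyε, h1, h2⟩
        ⟨e', y', he', hgap', hx', h0', hyε', h1', h2'⟩
      have key : ∀ e y e' y', (∀ c, c ∈ C → e < c → e + ε ≤ c) → e' ∈ C → e + y = x →
          e' + y' = x → y < ε → 0 ≤ y' → e' ≤ e := by
        intro e y e' y' hgap he' hx hx' hyε h0'
        by_contra! hlt
        have h3 : x < e + ε := hx ▸ (add_lt_add_iff_left e).2 hyε
        have h4 : e' ≤ x := hx' ▸ le_add_of_nonneg_right h0'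
        exact absurd (h3.trans_le (hgap e' he' hlt)) (not_lt.2 h4)
      obtain rfl : e = e' := le_antisymm (key e' y' e y hgap' he hx' hx hyε' h0)
        (key e y e' y' hgap he' hx hx' hyε h0')
      obtain rfl : y = y' := add_left_cancel (hx.trans hx'.symm)
      rcases hne.lt_or_gt with h | h
      · exact absurd (h2.trans_le ((ht.monotone (Nat.succ_le_of_lt h)).trans h1')) (lt_irrefl _)
      · exact absurd (h2'.trans_le ((ht.monotone (Nat.succ_le_of_lt h)).trans h1)) (lt_irrefl _)
    · intro η hη
      have hdA := hd _ (hη 0)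
      have htη := htε (η 1)
      refine ⟨d (η 0) + t (η 1), Fin.forall_fin_two.2 ⟨⟨?_, ?_⟩, ?_⟩, ?_, ?_⟩
      · exact le_add_of_nonneg_right htη.1.le
      · exact (add_lt_add_iff_left _).2 htη.2
      · exact ⟨_, _, hC' _ hdA, hAε _ hdA, rfl, htη.1.le, htη.2, le_rfl, ht (Nat.lt_succ_self _)⟩
      · exact fun c hc => ((add_lt_add_iff_left _).2 htη.2).trans_le
          (hAε _ hdA c (hC' c (hFA hc)) (hlt _ (hη 0) c hc))
      · exact fun hpos => add_nonneg (hpos _ (hC' _ hdA)).le htη.1.le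

end Arrays

/-! ### Gap lengths that accumulate from the right. -/

section DenseGaps

variable {L : FirstOrder.Language.{u, v}} {R : Type w} [AddCommGroup R] [LinearOrder R]
  [L.Structure R] {C : Set R}

/-- The gaps of `C` that start below `x` are dense among those with lengths in `(u, v)`. -/
def GapsDenseBelow (C : Set R) (u v x : R) : Prop :=
  ∀ u', ∀ v', u ≤ u' → v' ≤ v → (∃ e, ∃ a, u' < e ∧ e < v' ∧ IsGap C a e) →
    ∃ a, ∃ g, a < x ∧ IsGap C a g ∧ u' < g ∧ g < v'

theorem GapsDenseBelow.mono {u v x y : R} (h : GapsDenseBelow C u v x) (hxy : x ≤ y) :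
    GapsDenseBelow C u v y := by
  intro u' v' hu hv he
  obtain ⟨a, g, ha, hg⟩ := h u' v' hu hv he
  exact ⟨a, g, ha.trans_le hxy, hg⟩

theorem definable_gapsDenseBelow (hexp : IsExpansion L R)
    (hC : (Set.univ : Set R).Definable₁ L C) (u v : R) :
    (Set.univ : Set R).Definable₁ L {x | ¬ GapsDenseBelow C u v x} := by
  have h : DefPred L (fun z : Fin 1 → R => ¬ GapsDenseBelow C u v (z 0)) := by
    refine DefPred.not (DefPred.all (DefPred.all ?_))
    refine (DefPred.le hexp (.const u) (.var _)).imp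
      ((DefPred.le hexp (.var _) (.const v)).imp (DefPred.imp ?_ ?_))
    · exact DefPred.ex (DefPred.ex ((DefPred.lt hexp (.var _) (.var _)).and
        ((DefPred.lt hexp (.var _) (.var _)).and (DefPred.isGap hexp hC (.var _) (.var _)))))
    · exact DefPred.ex (DefPred.ex ((DefPred.lt hexp (.var _) (.var _)).and
        ((DefPred.isGap hexp hC (.var _) (.var _)).and
          ((DefPred.lt hexp (.var _) (.var _)).and (DefPred.lt hexp (.var _) (.var _))))))
  exact h

variable [IsOrderedAddMonoid R]

/-- Gaps of length at least `p` cannot have two starts in one interval of length `p`. -/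
theorem IsGap.eq_of_lt_add {a g a' g' z p : R} (h : IsGap C a g) (h' : IsGap C a' g')
    (hg : p ≤ g) (hg' : p ≤ g') (hz : z ≤ a) (hz' : z ≤ a') (ha : a < z + p)
    (ha' : a' < z + p) : a = a' := by
  rcases lt_trichotomy a a' with hlt | heq | hlt
  · exact absurd ((ha'.trans_le (add_le_add hz hg)).trans_le (h.2.2.2 _ h'.1 hlt)) (lt_irrefl _)
  · exact heq
  · exact absurd ((ha.trans_le (add_le_add hz' hg')).trans_le (h'.2.2.2 _ h.1 hlt)) (lt_irrefl _)

/-- Accumulation splits `(u', v')` at a length `e₁` into two windows that both contain lengths. Each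
window has a gap starting below `y`. The two starts differ and cannot both lie in `[z, z + p)`, so
one lies below `z`. -/
theorem GapsDenseBelow.of_lt_add {p q u v z y : R}
    (hacc : ∀ e ∈ diffSet C, p ≤ e → e < q → ∀ u > e, ∃ c ∈ diffSet C, e < c ∧ c < u)
    (hu : p ≤ u) (hv : v ≤ q) (h : GapsDenseBelow C u v y) (hy : y ≤ z + p) :
    GapsDenseBelow C u v z := by
  rintro u' v' hu' hv' ⟨e, a, he, he', ha⟩
  have hpe : p ≤ e := (hu.trans hu').trans he.le
  obtain ⟨e₁, he₁, hlt, hlt'⟩ := hacc e (mem_diffSet_iff.2 ⟨a, ha⟩) hpe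
    (he'.trans_le (hv'.trans hv)) v' he'
  obtain ⟨e₂, he₂, hlt₂, hlt₂'⟩ := hacc e₁ he₁ (hpe.trans hlt.le)
    (hlt'.trans_le (hv'.trans hv)) v' hlt'
  obtain ⟨b₂, hb₂⟩ := mem_diffSet_iff.1 he₂
  obtain ⟨a₁, g₁, ha₁, hg₁, h₁, h₁'⟩ := h u' e₁ hu' (hlt'.le.trans hv') ⟨e, a, he, hlt, ha⟩
  obtain ⟨a₂, g₂, ha₂, hg₂, h₂, h₂'⟩ := h e₁ v' (hu'.trans (he.trans hlt).le) hv'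
    ⟨e₂, b₂, hlt₂, hlt₂', hb₂⟩
  by_cases hz₁ : a₁ < z
  · exact ⟨a₁, g₁, hz₁, hg₁, h₁, h₁'.trans hlt'⟩
  by_cases hz₂ : a₂ < z
  · exact ⟨a₂, g₂, hz₂, hg₂, (he.trans hlt).trans h₂, h₂'⟩
  obtain rfl := hg₁.eq_of_lt_add hg₂ ((hu.trans hu').trans h₁.le)
    ((hpe.trans hlt.le).trans h₂.le) (not_lt.1 hz₁) (not_lt.1 hz₂) (ha₁.trans_le hy)
    (ha₂.trans_le hy)
  have : g₁ = g₂ := (InCell.unique ⟨hg₁, le_rfl, hg₁.2.2.1⟩ ⟨hg₂, le_rfl, hg₂.2.2.1⟩).2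
  exact absurd (h₁'.trans h₂) (this ▸ lt_irrefl _)

/-- Otherwise the points where density fails have a supremum `s`. Density holds just above `s`, and
shifting down by `p` transfers it to failing points near `s`. -/
theorem gapsDenseBelow_of_gapsDenseBelow [DenselyOrdered R] (hexp : IsExpansion L R)
    (hdc : DefinablyComplete L R) (hC : (Set.univ : Set R).Definable₁ L C) {p q u v x : R}
    (hp : 0 < p)
    (hacc : ∀ e ∈ diffSet C, p ≤ e → e < q → ∀ u > e, ∃ c ∈ diffSet C, e < c ∧ c < u)
    (hu : p ≤ u) (hv : v ≤ q) (h : GapsDenseBelow C u v x) (y : R) :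
    GapsDenseBelow C u v y := by
  by_contra hy
  have hbdd : ∀ z ∈ {z | ¬ GapsDenseBelow C u v z}, z ≤ x := fun z hz =>
    le_of_not_ge fun hxz => hz (h.mono hxz)
  obtain ⟨s, hs⟩ := hdc _ (definable_gapsDenseBelow hexp hC u v) ⟨y, hy⟩ ⟨x, hbdd⟩
  obtain ⟨δ, hδ, hδp⟩ := exists_between hp
  have hlow : ∃ z, ¬ GapsDenseBelow C u v z ∧ s - δ < z := by
    by_contra! hcon
    have h' : s ≤ s - δ := hs.2 fun z hz => hcon z hz
    exact absurd (sub_lt_self s hδ) (not_lt.2 h')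
  obtain ⟨z, hz, hsz⟩ := hlow
  have hup : GapsDenseBelow C u v (s + (p - δ)) := by
    by_contra hcon
    exact absurd (hs.1 hcon) (not_le.2 (lt_add_of_pos_right s (sub_pos.2 hδp)))
  refine hz (hup.of_lt_add hacc hu hv ?_)
  have h' : s - δ + p ≤ z + p := add_le_add_left hsz.le p
  calc s + (p - δ) = s - δ + p := by abel
    _ ≤ z + p := h'

/-- If the set of gap lengths of `C` has no right-isolated points in some interval, then there are
infinitely many disjoint intervals such that gaps with lengths in each of them occur arbitrarily far
to the left, or arbitrarily far to the right. -/
theorem exists_unbounded_gaps [DenselyOrdered R] (hexp : IsExpansion L R)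
    (hdc : DefinablyComplete L R) (hC : (Set.univ : Set R).Definable₁ L C) {p q : R} (hp : 0 < p)
    (hp' : p ∈ diffSet C) (hpq : p < q)
    (hacc : ∀ e ∈ diffSet C, p ≤ e → e < q → ∀ u > e, ∃ c ∈ diffSet C, e < c ∧ c < u) :
    ∃ h : ℕ → R, StrictMono h ∧ (∀ j, p < h j) ∧
      ((∀ x j, ∃ a g, a < x ∧ IsGap C a g ∧ h j < g ∧ g < h (j + 1)) ∨
        ∀ x j, ∃ a g, x ≤ a ∧ IsGap C a g ∧ h j < g ∧ g < h (j + 1)) := by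
  have hseq : ∀ u v, p ≤ u → v ≤ q → (∃ e ∈ diffSet C, u < e ∧ e < v) →
      ∃ h : ℕ → R, StrictMono h ∧ (∀ j, u < h j ∧ h j < v) ∧
        ∀ j, ∃ e ∈ diffSet C, h j < e ∧ e < h (j + 1) := by
    rintro u v hu hv ⟨e, he, hue, hev⟩
    have hno : NoMaxOrder {e // e ∈ diffSet C ∧ u < e ∧ e < v} := ⟨fun e => by
      obtain ⟨c, hc, h1, h2⟩ := hacc e.1 e.2.1 (hu.trans e.2.2.1.le) (e.2.2.2.trans_le hv) v e.2.2.2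
      exact ⟨⟨c, hc, e.2.2.1.trans h1, h2⟩, h1⟩⟩
    have : Nonempty {e // e ∈ diffSet C ∧ u < e ∧ e < v} := ⟨⟨e, he, hue, hev⟩⟩
    obtain ⟨k, hk⟩ := Nat.exists_strictMono {e // e ∈ diffSet C ∧ u < e ∧ e < v}
    -- Even terms bound the windows, and odd terms are lengths inside them.
    refine ⟨fun j => (k (2 * j)).1, fun i j hij => hk (by omega), fun j => (k (2 * j)).2.2,
      fun j => ⟨(k (2 * j + 1)).1, (k (2 * j + 1)).2.1, hk (by omega), hk (by omega)⟩⟩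
  by_cases hA : ∃ u v x, p ≤ u ∧ v ≤ q ∧ (∃ e ∈ diffSet C, u < e ∧ e < v) ∧
      GapsDenseBelow C u v x
  · obtain ⟨u, v, x, hu, hv, he, hx⟩ := hA
    obtain ⟨h, hmono, hh, hmem⟩ := hseq u v hu hv he
    refine ⟨h, hmono, fun j => hu.trans_lt (hh j).1, Or.inl fun y j => ?_⟩
    obtain ⟨e, he, h1, h2⟩ := hmem j
    obtain ⟨a, ha⟩ := mem_diffSet_iff.1 he
    exact gapsDenseBelow_of_gapsDenseBelow hexp hdc hC hp hacc hu hv hx y _ _ (hh j).1.le (hh (j + 1)).2.le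
      ⟨e, a, h1, h2, ha⟩
  -- Density now fails below every `x` in every window, so each window has a subwindow whose lengths
  -- occur, but only at gaps starting at or after `x`.
  · push Not at hA
    obtain ⟨c, hc, h1, h2⟩ := hacc p hp' le_rfl hpq q hpq
    obtain ⟨h, hmono, hh, hmem⟩ := hseq p q le_rfl le_rfl ⟨c, hc, h1, h2⟩
    refine ⟨h, hmono, fun j => (hh j).1, Or.inr fun x j => ?_⟩
    have hnot := hA (h j) (h (j + 1)) x (hh j).1.le (hh (j + 1)).2.le (hmem j)
    simp only [GapsDenseBelow] at hnot
    push Not at hnot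
    obtain ⟨u', v', hu', hv', ⟨e, a, he, he', ha⟩, hlow⟩ := hnot
    refine ⟨a, e, ?_, ha, hu'.trans_lt he, he'.trans_le hv'⟩
    by_contra! hax
    exact absurd (hlow a e hax ha he) (not_le.2 he')

/-- There are arbitrarily many consecutive intervals in each of which gaps with lengths in
arbitrarily many disjoint intervals occur. -/
theorem exists_gap_grid {p : R} {h : ℕ → R}
    (hh : (∀ x j, ∃ a g, a < x ∧ IsGap C a g ∧ h j < g ∧ g < h (j + 1)) ∨
      ∀ x j, ∃ a g, x ≤ a ∧ IsGap C a g ∧ h j < g ∧ g < h (j + 1)) (K N : ℕ) :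
    ∃ X : ℕ → R, Monotone X ∧ ∀ k < K, ∀ j < N, ∃ a g, X k ≤ a ∧ a + p ≤ X (k + 1) ∧
      IsGap C a g ∧ h j < g ∧ g < h (j + 1) := by
  rcases hh with hh | hh
  · have hstep : ∀ x, ∃ y, y ≤ x ∧ ∀ j < N, ∃ a g, y ≤ a ∧ a + p ≤ x ∧
        IsGap C a g ∧ h j < g ∧ g < h (j + 1) := by
      intro x
      choose a g hax ha using hh (x - p)
      obtain ⟨y, hy⟩ := ((Finset.range N).image a ∪ {x}).bddBelow
      refine ⟨y, hy (by simp), fun j hj => ⟨a j, g j, hy ?_, (lt_sub_iff_add_lt.1 (hax j)).le, ha j⟩⟩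
      simp only [Finset.coe_union, Finset.coe_image, Set.mem_union, Set.mem_image]
      exact Or.inl ⟨j, by simpa using hj, rfl⟩
    choose f hf hfa using hstep
    -- The intervals are built from right to left, hence the reversed index.
    refine ⟨fun k => f^[K - k] 0, ?_, fun k hk j hj => ?_⟩
    · refine monotone_nat_of_le_succ fun k => ?_
      rcases Nat.lt_or_ge k K with hk | hk
      · obtain ⟨m, rfl⟩ := Nat.exists_eq_add_of_lt hk
        have h1 : k + m + 1 - k = m + 1 := by omega
        have h2 : k + m + 1 - (k + 1) = m := by omega
        simp only [h1, h2, Function.iterate_succ_apply']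
        exact hf _
      · have h1 : K - k = K - (k + 1) := by omega
        simp only [h1, le_refl]
    · obtain ⟨m, rfl⟩ := Nat.exists_eq_add_of_lt hk
      have h1 : k + m + 1 - k = m + 1 := by omega
      have h2 : k + m + 1 - (k + 1) = m := by omega
      simp only [h1, h2, Function.iterate_succ_apply']
      exact hfa _ j hj
  · have hstep : ∀ x, ∃ y, x ≤ y ∧ ∀ j < N, ∃ a g, x ≤ a ∧ a + p ≤ y ∧
        IsGap C a g ∧ h j < g ∧ g < h (j + 1) := by
      intro x
      choose a g hax ha using hh x
      obtain ⟨y, hy⟩ := ((Finset.range N).image (fun j => a j + p) ∪ {x}).bddAbove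
      refine ⟨y, hy (by simp), fun j hj => ⟨a j, g j, hax j, hy ?_, ha j⟩⟩
      simp only [Finset.coe_union, Finset.coe_image, Set.mem_union, Set.mem_image]
      exact Or.inl ⟨j, by simpa using hj, rfl⟩
    choose f hf hfa using hstep
    refine ⟨fun k => f^[k] 0, ?_, fun k _ j hj => ?_⟩
    · refine monotone_nat_of_le_succ fun k => ?_
      simp only [Function.iterate_succ_apply']
      exact hf _
    · simp only [Function.iterate_succ_apply']
      exact hfa _ j hj

/-- The rows are the grid interval containing `x`, the length of its cell and its offset. Offsets
are taken below `p`, which is less than all the lengths used, so every combination occurs. -/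
theorem hasArrays_three [DenselyOrdered R] (hexp : IsExpansion L R)
    (hdc : DefinablyComplete L R) (hC : (Set.univ : Set R).Definable₁ L C)
    (hinf : (diffSet C).Infinite)
    (hfin : {e ∈ diffSet C | RightIsolated (diffSet C) e}.Finite) : HasArrays L C 3 := by
  obtain ⟨p, hp', hpiso⟩ := (hinf.sdiff hfin).nonempty
  have hp : 0 < p := diffSet_pos p hp'
  -- Only finitely many lengths are right-isolated, so some interval `[p, q)` contains none.
  obtain ⟨q, hpq, hq⟩ : ∃ q > p, ∀ e ∈ diffSet C, RightIsolated (diffSet C) e → p < e → q ≤ e := by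
    obtain ⟨ε, hε, h⟩ := exists_pos_forall_le ⟨p, hp⟩ (hfin.toFinset.filter (p < ·))
      (fun e => e - p) (fun e he => sub_pos.2 (Finset.mem_filter.1 he).2)
    refine ⟨p + ε, lt_add_of_pos_right p hε, fun e he hiso hpe => ?_⟩
    have := h e (Finset.mem_filter.2 ⟨hfin.mem_toFinset.2 ⟨he, hiso⟩, hpe⟩)
    exact le_sub_iff_add_le'.1 this
  have hacc : ∀ e ∈ diffSet C, p ≤ e → e < q → ∀ u > e, ∃ c ∈ diffSet C, e < c ∧ c < u := by
    intro e he hpe heq u hu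
    by_contra! hcon
    have hiso : RightIsolated (diffSet C) e :=
      ⟨u - e, sub_pos.2 hu, fun c hc hec => by simpa using hcon c hc hec⟩
    rcases hpe.eq_or_lt with rfl | hlt
    · exact hpiso ⟨he, hiso⟩
    · exact absurd heq (not_lt.2 (hq e he hiso hlt))
  obtain ⟨h, hmono, hph, hgaps⟩ := exists_unbounded_gaps hexp hdc hC hp hp' hpq hacc
  obtain ⟨t, ht, htp⟩ := exists_strictMono_Ioo hp
  let S₀ : R → (Fin 3 → R) → Prop := fun x s => s 0 ≤ x ∧ x < s 1
  let S₁ : R → (Fin 3 → R) → Prop := fun x s => ∃ a, ∃ g, InCell C x a g ∧ s 0 ≤ g ∧ g < s 1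
  let S₂ : R → (Fin 3 → R) → Prop := fun x s =>
    ∃ a, ∃ g, ∃ y, InCell C x a g ∧ a + y = x ∧ s 0 ≤ y ∧ y < s 1
  have hdisj : ∀ X : ℕ → R, Monotone X → ∀ j j', j ≠ j' → ∀ x, X j ≤ x → x < X (j + 1) →
      ¬ (X j' ≤ x ∧ x < X (j' + 1)) := by
    rintro X hX j j' hne x h1 h2 ⟨h1', h2'⟩
    rcases hne.lt_or_gt with hlt | hlt
    · exact absurd (h2.trans_le ((hX (Nat.succ_le_of_lt hlt)).trans h1')) (lt_irrefl _)
    · exact absurd (h2'.trans_le ((hX (Nat.succ_le_of_lt hlt)).trans h1)) (lt_irrefl _)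
  have hforall : ∀ {P : Fin 3 → Prop}, P 0 → P 1 → P 2 → ∀ i, P i := fun h0 h1 h2 i => by
    fin_cases i
    exacts [h0, h1, h2]
  refine ⟨![S₀, S₁, S₂], hforall ?_ ?_ ?_, fun N M => ?_⟩
  · exact (DefPred.le hexp (.var _) (.var _)).and (DefPred.lt hexp (.var _) (.var _))
  · exact DefPred.ex (DefPred.ex ((DefPred.inCell hexp hC (.var _) (.var _) (.var _)).and
      ((DefPred.le hexp (.var _) (.var _)).and (DefPred.lt hexp (.var _) (.var _)))))
  · exact DefPred.ex (DefPred.ex (DefPred.ex ((DefPred.inCell hexp hC (.var _) (.var _)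
      (.var _)).and ((DefPred.eq (.add hexp (.var _) (.var _)) (.var _)).and
      ((DefPred.le hexp (.var _) (.var _)).and (DefPred.lt hexp (.var _) (.var _)))))))
  -- The last `M` intervals supply the points of `F`. The width `N + 1` ensures a gap in each of
  -- them even if `N = 0`.
  · obtain ⟨X, hX, hgrid⟩ := exists_gap_grid hgaps (N + M) (N + 1)
    have htop : ∀ i : Fin M, ∃ a g, X (N + i) ≤ a ∧ a + p ≤ X (N + i + 1) ∧ IsGap C a g :=
      fun i => by
        obtain ⟨a, g, h1, h2, h3, -⟩ := hgrid (N + i) (by omega) 0 (by omega)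
        exact ⟨a, g, h1, h2, h3⟩
    choose b b' hb1 hb2 hb3 using htop
    have hb : StrictMono b := fun i i' hii => by
      have h1 : b i < b i + p := lt_add_of_pos_right _ hp
      have h2 : X (N + i + 1) ≤ X (N + i') := hX (by have := Fin.lt_def.1 hii; omega)
      exact ((h1.trans_le (hb2 i)).trans_le h2).trans_le (hb1 i')
    refine ⟨![fun j => ![X j, X (j + 1), 0], fun j => ![h j, h (j + 1), 0],
      fun j => ![t j, t (j + 1), 0] ], Finset.univ.map ⟨b, hb.injective⟩, by simp, ?_,
      hforall ?_ ?_ ?_, fun η hη => ?_⟩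
    · intro c hc
      obtain ⟨i, -, rfl⟩ := Finset.mem_map.1 hc
      exact (hb3 i).1
    · rintro j - j' - hne x ⟨h1, h2⟩
      exact hdisj X hX j j' hne x h1 h2
    · rintro j - j' - hne x ⟨a, g, hcell, h1, h2⟩ ⟨a', g', hcell', h'⟩
      obtain ⟨rfl, rfl⟩ := hcell.unique hcell'
      exact hdisj h hmono.monotone j j' hne g h1 h2 h'
    · rintro j - j' - hne x ⟨a, g, y, hcell, hy, h1, h2⟩ ⟨a', g', y', hcell', hy', h'⟩
      obtain ⟨rfl, rfl⟩ := hcell.unique hcell'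
      obtain rfl : y = y' := add_left_cancel (hy.trans hy'.symm)
      exact hdisj t ht.monotone j j' hne y h1 h2 h'
    · obtain ⟨a, g, h1, h2, hgap, h3, h4⟩ := hgrid (η 0) (by have := hη 0; omega) (η 1)
        (by have := hη 1; omega)
      have ht2 := htp (η 2)
      have hxp : a + t (η 2) < a + p := (add_lt_add_iff_left a).2 ht2.2
      have hcell : InCell C (a + t (η 2)) a g := ⟨hgap, le_add_of_nonneg_right ht2.1.le,
        (add_lt_add_iff_left a).2 ((ht2.2.trans (hph _)).trans h3)⟩
      refine ⟨a + t (η 2), hforall ⟨h1.trans hcell.2.1, hxp.trans_le h2⟩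
        ⟨a, g, hcell, h3.le, h4⟩ ⟨a, g, _, hcell, rfl, le_rfl, ht (Nat.lt_succ_self _)⟩, ?_, ?_⟩
      · intro c hc
        obtain ⟨i, -, rfl⟩ := Finset.mem_map.1 hc
        have h5 : X (η 0 + 1) ≤ X (N + i) := hX (by have := hη 0; omega)
        exact ((hxp.trans_le h2).trans_le h5).trans_le (hb1 i)
      · exact fun hpos => add_nonneg (hpos a hgap.1).le ht2.1.le

end DenseGaps

theorem rightIsolated_of_isDiscrete {R : Type w} [AddCommGroup R] [LinearOrder R]
    [IsOrderedAddMonoid R] [TopologicalSpace R] [OrderTopology R] [Nontrivial R] {D : Set R}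
    (hD : IsDiscrete D) {e : R} (he : e ∈ D) : RightIsolated D e := by
  obtain ⟨U, hU, hUD⟩ := isDiscrete_iff_forall_mem_exists_isOpen.1 hD e he
  have heU : e ∈ U := (hUD.ge (Set.mem_singleton e)).1
  obtain ⟨a, b, ⟨hae, heb⟩, hab⟩ := mem_nhds_iff_exists_Ioo_subset.1 (hU.mem_nhds heU)
  refine ⟨b - e, sub_pos.2 heb, fun c hc hec => ?_⟩
  by_contra! hcb
  rw [add_sub_cancel] at hcb
  have hce : c ∈ ({e} : Set R) := hUD.le ⟨hab ⟨hae.trans hec, hcb⟩, hc⟩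
  exact hec.ne' hce

end OAG

/- The hypothesis `hstrong` is not needed: whenever `iterDiffSet D n` is infinite, a pattern of the
required finite depth in one variable is constructed outright. -/
theorem theorem2 (L : FirstOrder.Language.{u, v}) (R : Type w) [AddCommGroup R] [LinearOrder R]
    [IsOrderedAddMonoid R] [TopologicalSpace R] [OrderTopology R] [L.Structure R]
    (hexp : OAG.IsExpansion L R)
    (hdc : OAG.DefinablyComplete L R)
    (hstrong : OAG.IsStrong.{u, v, w} (L.completeTheory R))
    (D : Set R) (hDdef : (Set.univ : Set R).Definable₁ L D) (hDdisc : IsDiscrete D) :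
    (∀ n : ℕ, (OAG.iterDiffSet D n).Infinite →
      OAG.BurdenGE.{u, v, max u v w} (L.completeTheory R) ((n + 1 : ℕ) : Cardinal) ∧
      (DenselyOrdered R →
        OAG.BurdenGE.{u, v, max u v w} (L.completeTheory R) ((n + 2 : ℕ) : Cardinal))) ∧
    (DenselyOrdered R → OAG.BurdenEq.{u, v, max u v w} (L.completeTheory R) 2 →
      (OAG.diffSet D).Finite) := by
  have main : ∀ n : ℕ, (OAG.iterDiffSet D n).Infinite →
      OAG.BurdenGE.{u, v, max u v w} (L.completeTheory R) ((n + 1 : ℕ) : Cardinal) ∧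
      (DenselyOrdered R →
        OAG.BurdenGE.{u, v, max u v w} (L.completeTheory R) ((n + 2 : ℕ) : Cardinal)) := by
    intro n hn
    refine ⟨not_not.2 ((OAG.hasArrays_one hn).of_iterDiffSet hexp hDdef).hasInpPattern,
      fun _ => not_not.2 (OAG.HasArrays.hasInpPattern (C := D) ?_)⟩
    by_cases hiso : {e ∈ OAG.iterDiffSet D n | OAG.RightIsolated (OAG.iterDiffSet D n) e}.Finite
    · cases n with
      | zero =>
        obtain ⟨x, -, y, -, hxy⟩ := hn.nontrivial
        have : Nontrivial R := ⟨x, y, hxy⟩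
        -- All points of the discrete set `D` are right-isolated, so for `n = 0` only
        -- `hasArrays_two` can apply.
        exact absurd (hiso.subset fun e he =>
          ⟨he, OAG.rightIsolated_of_isDiscrete hDdisc he⟩) hn
      | succ n =>
        have h := (OAG.hasArrays_three hexp hdc (OAG.definable_iterDiffSet hexp hDdef n) hn
          hiso).of_iterDiffSet hexp hDdef
        rwa [Nat.add_right_comm]
    · exact (OAG.hasArrays_two hexp (OAG.definable_iterDiffSet hexp hDdef n)
        hiso).of_iterDiffSet hexp hDdef
  refine ⟨main, fun hdense hburden => ?_⟩
  by_contra hinf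
  -- Burden `2` means burden less than `3`, against the bound `1 + 2` for an infinite `diffSet D`.
  refine (main 1 hinf).2 hdense ?_
  have h := hburden.1
  rw [Set.mem_ofPred_eq] at h
  convert h using 1
  have hsucc := Cardinal.succ_natCast 2
  rw [Nat.cast_ofNat] at hsucc
  rw [hsucc]
  norm_num
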